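/- For $\Omega\subseteq\mathbb{C}$, a polynomial $p\in\mathbb{C}[z]$ is called $\Omega$-stable if $p(z)\neq 0$ for all $z\in\Omega$. Let $\mathbb{C}_n[z]$ denote the space of polynomials in $\mathbb{C}[z]$ of degree at most $n$ ($n\ge 0$), let $\mathcal{P}(\Omega)$ be the set of $\Omega$-stable polynomials and $\mathcal{P}_n(\Omega)=\mathcal{P}(\Omega)\cap\mathbb{C}_n[z]$. A linear operator $T:\mathbb{C}_n[z]\to\mathbb{C}[z]$ preserves $\Omega$-stability if $T(\mathcal{P}_n(\Omega))\subseteq\mathcal{P}(\Omega)\cup\{0\}$. Theorem 1.2. Let $H_1$ and $H_2$ be two parallel open half-planes in $\mathbb{C}$ such that $\mathbb{C}\setminus(H_1\cup H_2)$ is a closed strip with non-empty interior, and let $T:\mathbb{C}_n[z]\to\mathbb{C}[z]$ be a linear operator. Then $T$ preserves $(H_1\cup H_2)$-stability if and only if at least one of the following holds: (i) $T$ has range of dimension at most one and is of the form $T[f]=\alpha(f)p$ for $f\in\mathbb{C}_n[z]$, where $\alpha:\mathbb{C}_n[z]\to\mathbb{C}$ is a linear functional and $p\in\mathcal{P}(H_1\cup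 H_2)$; (ii) $T$ satisfies both (a) and (b): (a) $T(\mathcal{P}_n(H_1))\subseteq\mathcal{P}(H_1)\cup\{0\}$ or $T(\mathcal{P}_n(H_2))\subseteq\mathcal{P}(H_1)\cup\{0\}$; (b) $T(\mathcal{P}_n(H_1))\subseteq\mathcal{P}(H_2)\cup\{0\}$ or $T(\mathcal{P}_n(H_2))\subseteq\mathcal{P}(H_2)\cup\{0\}$. -/

import Mathlib

open Polynomial

/-- The open half-plane `{z : c < Re (conj u * z)}`, with inner normal direction `u` (for `u ≠ 0`). -/
def openHalfPlane (u : ℂ) (c : ℝ) : Set ℂ :=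
  {z : ℂ | c < ((starRingEnd ℂ) u * z).re}

/-- `H₁` and `H₂` are open half-planes with parallel boundary lines
(their inner normals point in the same or in opposite directions). -/
def AreParallelOpenHalfPlanes (H₁ H₂ : Set ℂ) : Prop :=
  ∃ u : ℂ, u ≠ 0 ∧ ∃ c₁ c₂ : ℝ, H₁ = openHalfPlane u c₁ ∧
    (H₂ = openHalfPlane u c₂ ∨ H₂ = openHalfPlane (-u) c₂)

/-- A closed strip: the closed region between two parallel lines. It may degenerate to a line. -/
def IsClosedStrip (S : Set ℂ) : Prop :=
  ∃ u : ℂ, u ≠ 0 ∧ ∃ a b : ℝ, a ≤ b ∧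
    S = {z : ℂ | a ≤ ((starRingEnd ℂ) u * z).re ∧ ((starRingEnd ℂ) u * z).re ≤ b}

/-- A polynomial is `Ω`-stable if it has no zero in `Ω`. -/
def IsStableOn (Ω : Set ℂ) (p : ℂ[X]) : Prop :=
  ∀ z ∈ Ω, p.eval z ≠ 0

/-- `T : 𝒫ₙ(Ω) → 𝒫(Ω') ∪ {0}`: the operator `T` on polynomials of degree at most `n` sends each
`Ω`-stable one to an `Ω'`-stable polynomial or to zero. -/
def MapsStable {n : ℕ} (T : degreeLE ℂ (n : WithBot ℕ) →ₗ[ℂ] ℂ[X]) (Ω Ω' : Set ℂ) : Prop :=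
  ∀ f : degreeLE ℂ (n : WithBot ℕ), IsStableOn Ω (f : ℂ[X]) → IsStableOn Ω' (T f) ∨ T f = 0

/-- `T` preserves `Ω`-stability. -/
def PreservesStability {n : ℕ} (T : degreeLE ℂ (n : WithBot ℕ) →ₗ[ℂ] ℂ[X]) (Ω : Set ℂ) : Prop :=
  MapsStable T Ω Ω

/-!
Write `S` for the open strip between the half-planes and `Ω = H₁ ∪ H₂`. Each of the two conditions
implies preservation directly, so the content is the converse.

*Degenerate operators.* If every `T f` is `Ω`-stable or zero, the range of `T` has dimension at most
one, because a two-dimensional space of polynomials contains a nonzero one vanishing at a given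
point of `Ω` (`rank_le_one_of_forall_stableOrZero`). Otherwise `T` kills no polynomial of degree `n`
or `n - 1` with all its roots in `S`: if `T g = 0`, then `T` applied to `Ω`-stable perturbations of
`g` shows that all of the range is stable or zero (`map_rootPoly_ne_zero`,
`map_rootPoly_ne_zero_of_card_succ`).

*Nondegenerate operators.* Fix a target half-plane `K` and consider `F(ζ₁, …, ζₙ; w) = T (∏ (X -
ζᵢ)) (w)`, which is symmetric and affine in each `ζᵢ`, and which has no zero for `ζᵢ ∈ S`, `w ∈ K`.
Its zero as a function of `ζ₁` alone depends continuously on the other variables in `S` and on `w ∈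
K`, and avoids `S`; by connectedness it stays on one fixed side of `S` (`half_plane_dichotomy`). So
`F` has no zero with `ζ₂, …, ζₙ ∈ S` and `ζ₁` in the open half-plane `G ⊇ S` that is the complement
of the closure of `H₁` or of `H₂`, according to that side. A lemma on symmetric biaffine forms in two variables
(`biaffine_ne_zero_of_half_plane`) then allows the remaining variables to be enlarged from `S` to
`G` one at a time (`functional_rootPoly_ne_zero`). Hence all monic polynomials of degree `n` with
their roots in `G` are mapped to `K`-stable ones. The general `H₁`-stable, respectively `H₂`-stable,
polynomial of degree at most `n` is a limit of such polynomials, and Hurwitz's theorem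
(`StableOrZero.of_perturbation`), which follows here from a Harnack inequality for polynomials,
finishes the proof (`stableOrZero_of_rootPoly`).
-/

open Filter Topology

/-! ### Products of linear factors -/

/-- The monic polynomial whose multiset of roots is `s`. -/
noncomputable def rootPoly (s : Multiset ℂ) : ℂ[X] := (s.map fun a => X - C a).prod

@[simp] lemma rootPoly_zero : rootPoly 0 = 1 := by simp [rootPoly]

@[simp] lemma rootPoly_cons (a : ℂ) (s : Multiset ℂ) :
    rootPoly (a ::ₘ s) = (X - C a) * rootPoly s := by simp [rootPoly]

lemma rootPoly_monic (s : Multiset ℂ) : (rootPoly s).Monic :=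
  monic_multiset_prod_of_monic _ _ fun a _ => monic_X_sub_C a

@[simp] lemma natDegree_rootPoly (s : Multiset ℂ) : (rootPoly s).natDegree = s.card :=
  natDegree_multiset_prod_X_sub_C_eq_card s

lemma eval_rootPoly (s : Multiset ℂ) (z : ℂ) :
    (rootPoly s).eval z = (s.map fun a => z - a).prod := by
  induction s using Multiset.induction with
  | empty => simp
  | cons a s ih => simp [ih]

lemma isStableOn_rootPoly {Ω : Set ℂ} {s : Multiset ℂ} (h : ∀ a ∈ s, a ∉ Ω) :
    IsStableOn Ω (rootPoly s) := by
  intro z hz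
  rw [eval_rootPoly]
  refine Multiset.prod_ne_zero fun hmem => ?_
  obtain ⟨a, ha, h0⟩ := Multiset.mem_map.mp hmem
  exact h a ha (by rwa [← sub_eq_zero.mp h0])

lemma eq_smul_rootPoly_roots (f : ℂ[X]) : f = f.leadingCoeff • rootPoly f.roots := by
  rw [rootPoly, smul_eq_C_mul]
  exact (IsAlgClosed.splits f).eq_prod_roots

/-! ### Limits of stable polynomials -/

/-- Membership in `𝒫(Ω) ∪ {0}`. -/
def StableOrZero (Ω : Set ℂ) (p : ℂ[X]) : Prop := IsStableOn Ω p ∨ p = 0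

lemma StableOrZero.smul {Ω : Set ℂ} {p : ℂ[X]} (h : StableOrZero Ω p) (c : ℂ) :
    StableOrZero Ω (c • p) := by
  rcases h with h | rfl
  · rcases eq_or_ne c 0 with rfl | hc
    · right; simp
    · left; intro z hz; simpa [hc] using h z hz
  · right; simp

lemma stableOrZero_smul_iff {Ω : Set ℂ} {p : ℂ[X]} {c : ℂ} (hc : c ≠ 0) :
    StableOrZero Ω (c • p) ↔ StableOrZero Ω p :=
  ⟨fun h => by simpa [smul_smul, hc] using h.smul c⁻¹, fun h => h.smul c⟩

/-- A Harnack inequality: each factor `x - a` of `p` is at most twice as large as `w - a`. -/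
lemma norm_eval_le_of_no_root_in_ball {p : ℂ[X]} {N : ℕ} (hN : p.natDegree ≤ N) {w x : ℂ} {r : ℝ}
    (hp : StableOrZero (Metric.ball w r) p) (hx : x ∈ Metric.ball w r) :
    ‖p.eval x‖ ≤ 2 ^ N * ‖p.eval w‖ := by
  rcases hp with hp | rfl
  swap
  · simp
  have key : ∀ s : Multiset ℂ, (∀ a ∈ s, a ∉ Metric.ball w r) →
      ‖(rootPoly s).eval x‖ ≤ 2 ^ s.card * ‖(rootPoly s).eval w‖ := by
    intro s
    induction s using Multiset.induction with
    | empty => simp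
    | cons a s ih =>
      intro hs
      have h1 := ih fun b hb => hs b (Multiset.mem_cons_of_mem hb)
      have h2 : ‖x - a‖ ≤ 2 * ‖w - a‖ := by
        have ha := hs a (Multiset.mem_cons_self a s)
        rw [Metric.mem_ball, not_lt, dist_comm, dist_eq_norm] at ha
        rw [Metric.mem_ball, dist_eq_norm] at hx
        have := norm_add_le (x - w) (w - a)
        rw [sub_add_sub_cancel] at this
        linarith
      simp only [rootPoly_cons, eval_mul, eval_sub, eval_X, eval_C, norm_mul, Multiset.card_cons,
        pow_succ]
      calc ‖x - a‖ * ‖(rootPoly s).eval x‖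
          ≤ (2 * ‖w - a‖) * (2 ^ s.card * ‖(rootPoly s).eval w‖) := by gcongr
        _ = _ := by ring
  have h := key p.roots fun a ha hb => hp a hb (isRoot_of_mem_roots ha)
  have h2 : (2 : ℝ) ^ p.roots.card ≤ 2 ^ N :=
    pow_le_pow_right₀ (by norm_num) ((card_roots' p).trans hN)
  rw [eq_smul_rootPoly_roots p, eval_smul, eval_smul, norm_smul, norm_smul]
  calc ‖p.leadingCoeff‖ * ‖(rootPoly p.roots).eval x‖
      ≤ ‖p.leadingCoeff‖ * (2 ^ p.roots.card * ‖(rootPoly p.roots).eval w‖) := by gcongr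
    _ ≤ ‖p.leadingCoeff‖ * (2 ^ N * ‖(rootPoly p.roots).eval w‖) := by gcongr
    _ = _ := by ring

/-- Hurwitz's theorem for a linear perturbation of a polynomial. -/
lemma StableOrZero.of_perturbation {K : Set ℂ} (hK : IsOpen K) {p q : ℂ[X]}
    (h : ∀ᶠ ε : ℝ in 𝓝[>] 0, StableOrZero K (p + (ε : ℂ) • q)) : StableOrZero K p := by
  by_contra hcon
  obtain ⟨hp, hp0⟩ : (∃ w ∈ K, p.eval w = 0) ∧ p ≠ 0 := by
    simpa [StableOrZero, IsStableOn] using hcon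
  obtain ⟨w, hw, hpw⟩ := hp
  obtain ⟨r, hr, hrK⟩ := Metric.isOpen_iff.mp hK w hw
  set N := max p.natDegree q.natDegree
  have tend : ∀ x : ℂ, Tendsto (fun ε : ℝ => ‖(p + (ε : ℂ) • q).eval x‖) (𝓝[>] 0)
      (𝓝 ‖p.eval x‖) := by
    intro x
    have hc : Continuous fun ε : ℝ => ‖(p + (ε : ℂ) • q).eval x‖ := by
      simp only [eval_add, eval_smul, smul_eq_mul]
      fun_prop
    simpa using (hc.tendsto 0).mono_left nhdsWithin_le_nhds
  have hzero : ∀ x ∈ Metric.ball w r, p.eval x = 0 := by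
    intro x hx
    have hle : ‖p.eval x‖ ≤ 2 ^ N * ‖p.eval w‖ := by
      refine le_of_tendsto_of_tendsto (tend x) ((tend w).const_mul _) ?_
      filter_upwards [h] with ε hε
      refine norm_eval_le_of_no_root_in_ball ?_ ?_ hx
      · exact (natDegree_add_le _ _).trans (max_le_max le_rfl (natDegree_smul_le _ _))
      · exact hε.imp_left fun h z hz => h z (hrK hz)
    rw [hpw, norm_zero, mul_zero] at hle
    exact norm_le_zero_iff.mp hle
  refine hp0 (eq_zero_of_infinite_isRoot p (Set.Infinite.mono (fun x hx => hzero x hx) ?_))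
  exact infinite_of_mem_nhds w (Metric.ball_mem_nhds w hr)

/-- If `p` has all its roots in the open set `U`, so has every small perturbation of `p` of no
larger degree. -/
lemma eventually_isStableOn_compl_perturbation {U : Set ℂ} (hU : IsOpen U) {s : Multiset ℂ}
    (hs : ∀ a ∈ s, a ∈ U) {q : ℂ[X]} (hq : q.natDegree ≤ s.card) :
    ∀ᶠ ε : ℝ in 𝓝[>] 0, IsStableOn Uᶜ (rootPoly s + (ε : ℂ) • q) := by
  have hA : ∃ A : ℝ, 0 ≤ A ∧ ∀ z ∉ U, (1 + ‖z‖) ^ s.card ≤ A * ‖(rootPoly s).eval z‖ := by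
    clear hq
    induction s using Multiset.induction with
    | empty => exact ⟨1, by simp, by simp⟩
    | cons a s ih =>
      obtain ⟨A, hA0, hA⟩ := ih fun b hb => hs b (Multiset.mem_cons_of_mem hb)
      obtain ⟨δ, hδ, hδU⟩ := Metric.isOpen_iff.mp hU a (hs a (Multiset.mem_cons_self a s))
      refine ⟨(1 + (1 + ‖a‖) / δ) * A, by positivity, fun z hz => ?_⟩
      have h1 : δ ≤ ‖z - a‖ := by
        by_contra hlt
        exact hz (hδU (by rw [Metric.mem_ball, dist_eq_norm]; exact not_le.mp hlt))
      have h2 : 1 + ‖z‖ ≤ (1 + (1 + ‖a‖) / δ) * ‖z - a‖ := by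
        have h3 : ‖z‖ ≤ ‖z - a‖ + ‖a‖ := by simpa using norm_add_le (z - a) a
        have h4 : 1 + ‖a‖ ≤ (1 + ‖a‖) / δ * ‖z - a‖ := by
          rw [div_mul_eq_mul_div, le_div_iff₀ hδ]
          gcongr
        linarith
      simp only [rootPoly_cons, eval_mul, eval_sub, eval_X, eval_C, norm_mul, Multiset.card_cons,
        pow_succ']
      calc (1 + ‖z‖) * (1 + ‖z‖) ^ s.card
          ≤ ((1 + (1 + ‖a‖) / δ) * ‖z - a‖) * (A * ‖(rootPoly s).eval z‖) := by
            gcongr; exact hA z hz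
        _ = _ := by ring
  obtain ⟨A, hA0, hA⟩ := hA
  set B : ℝ := ∑ i ∈ Finset.range (s.card + 1), ‖q.coeff i‖
  have hB : ∀ z, ‖q.eval z‖ ≤ B * (1 + ‖z‖) ^ s.card := by
    intro z
    rw [eval_eq_sum_range' (Nat.lt_succ_of_le hq), Finset.sum_mul]
    refine (norm_sum_le _ _).trans (Finset.sum_le_sum fun i hi => ?_)
    rw [norm_mul, norm_pow]
    gcongr
    have hi' : i ≤ s.card := Nat.lt_succ_iff.mp (Finset.mem_range.mp hi)
    calc ‖z‖ ^ i ≤ (1 + ‖z‖) ^ i := by gcongr; linarith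
      _ ≤ (1 + ‖z‖) ^ s.card := pow_le_pow_right₀ (by linarith [norm_nonneg z]) hi'
  have hsmall : ∀ᶠ ε : ℝ in 𝓝[>] 0, ε * (B * A) < 1 := by
    have hc : Continuous fun ε : ℝ => ε * (B * A) := by fun_prop
    have := (hc.tendsto 0).mono_left (nhdsWithin_le_nhds (s := Set.Ioi 0))
    rw [zero_mul] at this
    exact this.eventually_lt_const one_pos
  filter_upwards [hsmall, self_mem_nhdsWithin] with ε hε hε0 z hz h0
  rw [Set.mem_Ioi] at hε0
  have hne : (rootPoly s).eval z ≠ 0 :=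
    isStableOn_rootPoly (Ω := Uᶜ) (fun a ha h => h (hs a ha)) z hz
  have h1 : ‖(rootPoly s).eval z‖ = ε * ‖q.eval z‖ := by
    rw [eval_add, eval_smul, smul_eq_mul] at h0
    rw [eq_neg_of_add_eq_zero_left h0, norm_neg, norm_mul, Complex.norm_real,
      Real.norm_of_nonneg hε0.le]
  have h2 : ‖(rootPoly s).eval z‖ ≤ ε * (B * A) * ‖(rootPoly s).eval z‖ := by
    calc _ = ε * ‖q.eval z‖ := h1
      _ ≤ ε * (B * (A * ‖(rootPoly s).eval z‖)) := by
        gcongr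
        refine (hB z).trans ?_
        gcongr
        exact hA z hz
      _ = _ := by ring
  nlinarith [norm_pos_iff.mpr hne]

/-! ### Operators with degenerate range -/

lemma rank_le_one_of_forall_stableOrZero {M : Type*} [AddCommGroup M] [Module ℂ M] {Ω : Set ℂ}
    (hΩ : Ω.Nonempty) (T : M →ₗ[ℂ] ℂ[X]) (h : ∀ f, StableOrZero Ω (T f)) :
    LinearMap.rank T ≤ 1 ∧
      ∃ (α : M →ₗ[ℂ] ℂ) (p : ℂ[X]), IsStableOn Ω p ∧ ∀ f, T f = α f • p := by
  obtain ⟨α, p, hp, hα⟩ :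
      ∃ (α : M →ₗ[ℂ] ℂ) (p : ℂ[X]), IsStableOn Ω p ∧ ∀ f, T f = α f • p := by
    by_cases h0 : ∀ f, T f = 0
    · exact ⟨0, 1, fun z _ => by simp, fun f => by simp [h0 f]⟩
    push Not at h0
    obtain ⟨f₀, hf₀⟩ := h0
    have hst : IsStableOn Ω (T f₀) := (h f₀).resolve_right hf₀
    obtain ⟨w, hw⟩ := hΩ
    have hne := hst w hw
    refine ⟨((T f₀).eval w)⁻¹ • (leval w ∘ₗ T), T f₀, hst, fun f => ?_⟩
    -- A combination of `T f` and `T f₀` that vanishes at `w ∈ Ω` is not stable, so it is zero.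
    rcases h (f - (((T f₀).eval w)⁻¹ * (T f).eval w) • f₀) with hs | hz
    · refine absurd ?_ (hs w hw)
      simp only [map_sub, map_smul, eval_sub, eval_smul, smul_eq_mul]
      field_simp
      simp
    · rw [map_sub, map_smul, sub_eq_zero] at hz
      simpa using hz
  refine ⟨?_, α, p, hp, hα⟩
  refine (Submodule.rank_mono (t := Submodule.span ℂ {p}) ?_).trans (rank_span_le _ |>.trans ?_)
  · rintro _ ⟨f, rfl⟩
    rw [hα f]
    exact Submodule.smul_mem _ _ (Submodule.mem_span_singleton_self p)
  · simp

section Operators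

variable {T : ℂ[X] →ₗ[ℂ] ℂ[X]} {n : ℕ} {Ω : Set ℂ}

/-- If `T` kills a polynomial with all its roots inside the open set `U`, it maps each small
perturbation, hence everything, to a stable polynomial or to zero. -/
lemma map_rootPoly_ne_zero {U : Set ℂ} (hU : IsOpen U) (hΩU : Ω ⊆ Uᶜ)
    (hT : ∀ f : ℂ[X], f.natDegree ≤ n → IsStableOn Ω f → StableOrZero Ω (T f))
    (hnd : ∃ f : ℂ[X], f.natDegree ≤ n ∧ ¬ StableOrZero Ω (T f))
    {s : Multiset ℂ} (hs : ∀ a ∈ s, a ∈ U) (hcard : s.card = n) : T (rootPoly s) ≠ 0 := by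
  intro h0
  obtain ⟨f, hf, hfT⟩ := hnd
  have hev := (eventually_isStableOn_compl_perturbation hU hs (q := f) (hcard ▸ hf)).and
    (self_mem_nhdsWithin (a := (0 : ℝ)) (s := Set.Ioi 0))
  obtain ⟨ε, hε, hpos⟩ := hev.exists
  have hε0 : (ε : ℂ) ≠ 0 := by exact_mod_cast (Set.mem_Ioi.mp hpos).ne'
  have h1 := hT (rootPoly s + (ε : ℂ) • f)
    ((natDegree_add_le _ _).trans (max_le (by simp [hcard]) ((natDegree_smul_le _ _).trans hf)))
    fun z hz => hε z (hΩU hz)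
  rw [map_add, h0, zero_add, map_smul, stableOrZero_smul_iff hε0] at h1
  exact hfT h1

variable {ℓ : ℂ →L[ℝ] ℝ} {lo hi : ℝ}

lemma isOpen_preimage_Ioo : IsOpen (ℓ ⁻¹' Set.Ioo lo hi) := isOpen_Ioo.preimage ℓ.continuous

/-- A linear factor `1 + ε (X - b) / v`, whose root runs to infinity along the line through `b` in
direction `v` as `ε → 0`. -/
noncomputable def distantFactor (b v : ℂ) (ε : ℝ) : ℂ[X] :=
  1 + (ε : ℂ) • (v⁻¹ • (X - C b))

lemma distantFactor_eq {b v : ℂ} (hv : v ≠ 0) {ε : ℝ} (hε : ε ≠ 0) :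
    distantFactor b v ε = ((ε : ℂ) * v⁻¹) • (X - C (b - ε⁻¹ • v)) := by
  have hε' : (ε : ℂ) ≠ 0 := by exact_mod_cast hε
  have h1 : (ε : ℂ) * v⁻¹ * ((ε : ℂ)⁻¹ * v) = 1 := by field_simp
  rw [distantFactor, smul_smul, Complex.real_smul, Complex.ofReal_inv, C_sub, smul_eq_C_mul,
    smul_eq_C_mul, ← sub_add, mul_add, ← C_mul, h1, C_1, add_comm]

lemma eval_distantFactor_ne_zero {b v z : ℂ} (hv : v ≠ 0) (hℓv : ℓ v = 0) {ε : ℝ} (hε : ε ≠ 0)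
    (hz : ℓ z ≠ ℓ b) : (distantFactor b v ε).eval z ≠ 0 := by
  have hε' : (ε : ℂ) ≠ 0 := by exact_mod_cast hε
  rw [distantFactor_eq hv hε, eval_smul, smul_eq_mul]
  refine mul_ne_zero (mul_ne_zero hε' (inv_ne_zero hv)) ?_
  rw [eval_sub, eval_X, eval_C]
  intro h
  rw [sub_eq_zero.mp h, map_sub, map_smul, hℓv, smul_zero, sub_zero] at hz
  exact hz rfl

lemma natDegree_distantFactor_le (b v : ℂ) (ε : ℝ) : (distantFactor b v ε).natDegree ≤ 1 := by
  unfold distantFactor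
  refine (natDegree_add_le _ _).trans (max_le (by simp) ?_)
  exact (natDegree_smul_le _ _).trans ((natDegree_smul_le _ _).trans (natDegree_X_sub_C b).le)

/-- In the space of polynomials of degree at most `n`, a polynomial of degree `n - 1` with its
roots in the strip has a further root at infinity, which is a boundary point of the strip. The
perturbations used are those that keep this root in the strip. -/
lemma map_rootPoly_ne_zero_of_card_succ (hΩ : Ω ⊆ (ℓ ⁻¹' Set.Ioo lo hi)ᶜ) (hΩo : IsOpen Ω)
    {b v : ℂ} (hv : v ≠ 0) (hℓv : ℓ v = 0) (hb : ℓ b ∈ Set.Ioo lo hi)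
    (hT : ∀ f : ℂ[X], f.natDegree ≤ n → IsStableOn Ω f → StableOrZero Ω (T f))
    (hnd : ∃ f : ℂ[X], f.natDegree ≤ n ∧ ¬ StableOrZero Ω (T f))
    {s : Multiset ℂ} (hs : ∀ a ∈ s, ℓ a ∈ Set.Ioo lo hi) (hcard : s.card + 1 = n) :
    T (rootPoly s) ≠ 0 := by
  intro h0
  set g := rootPoly s with hg
  have hgdeg : g.natDegree = s.card := natDegree_rootPoly s
  have step (q : ℂ[X]) (hq : q.natDegree ≤ s.card) : StableOrZero Ω (T (v⁻¹ • (X * g) + q)) := by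
    -- `T` maps `(1 + ε (X - b) / v) (g + ε q)` to `ε T (X g / v + q)` plus terms of order `ε²`.
    have hlim : ∀ᶠ ε : ℝ in 𝓝[>] 0, StableOrZero Ω
        (T (v⁻¹ • (X * g) + q) + (ε : ℂ) • T (v⁻¹ • ((X - C b) * q))) := by
      filter_upwards [eventually_isStableOn_compl_perturbation
        (isOpen_preimage_Ioo (ℓ := ℓ) (lo := lo) (hi := hi)) hs hq, self_mem_nhdsWithin]
        with ε hε hpos
      have hεR : ε ≠ 0 := (Set.mem_Ioi.mp hpos).ne'
      have hε0 : (ε : ℂ) ≠ 0 := by exact_mod_cast hεR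
      have h1 := hT (distantFactor b v ε * (g + (ε : ℂ) • q)) ?_ ?_
      · have h2 : distantFactor b v ε * (g + (ε : ℂ) • q) = (1 - (ε : ℂ) * v⁻¹ * b) • g +
            (ε : ℂ) • ((v⁻¹ • (X * g) + q) + (ε : ℂ) • (v⁻¹ • ((X - C b) * q))) := by
          simp only [distantFactor, smul_eq_C_mul, C_sub, C_mul, C_1]
          ring
        rw [h2, map_add, map_smul, h0, smul_zero, zero_add, map_smul,
          stableOrZero_smul_iff hε0, map_add, map_smul] at h1
        exact h1
      · refine natDegree_mul_le.trans ?_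
        have h3 := natDegree_distantFactor_le b v ε
        have h4 : (g + (ε : ℂ) • q).natDegree ≤ s.card :=
          (natDegree_add_le _ _).trans (max_le hgdeg.le ((natDegree_smul_le _ _).trans hq))
        omega
      · intro z hz
        rw [eval_mul]
        refine mul_ne_zero (eval_distantFactor_ne_zero hv hℓv hεR ?_) (hε z (hΩ hz))
        intro h
        exact hΩ hz (by rw [Set.mem_preimage, h]; exact hb)
    exact StableOrZero.of_perturbation hΩo hlim
  have step' (c : ℂ) (hc : c ≠ 0) (q : ℂ[X]) (hq : q.natDegree ≤ s.card) :
      StableOrZero Ω (T (c • (X * g) + q)) := by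
    have h1 := (step ((c * v)⁻¹ • q) ((natDegree_smul_le _ _).trans hq)).smul (c * v)
    rw [← map_smul, smul_add, smul_smul, smul_smul, mul_inv_cancel₀ (mul_ne_zero hc hv), one_smul,
      mul_inv_cancel_right₀ hv] at h1
    exact h1
  obtain ⟨f, hf, hfT⟩ := hnd
  refine hfT ?_
  have hXg : (X * g).Monic := monic_X.mul (rootPoly_monic s)
  have hXgdeg : (X * g).natDegree = n := by
    rw [monic_X.natDegree_mul (rootPoly_monic s), natDegree_X, hgdeg]; omega
  set c := f.coeff n
  have hq : (f - c • (X * g)).natDegree ≤ s.card := by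
    rw [natDegree_le_iff_coeff_eq_zero]
    intro i hi
    rcases (show n ≤ i by omega).eq_or_lt with rfl | hlt
    · have : (X * g).coeff n = 1 := by rw [← hXgdeg]; exact hXg
      rw [coeff_sub, coeff_smul, this, smul_eq_mul, mul_one, sub_self]
    · rw [coeff_sub, coeff_smul, coeff_eq_zero_of_natDegree_lt (hf.trans_lt hlt),
        coeff_eq_zero_of_natDegree_lt (hXgdeg.le.trans_lt hlt), smul_zero, sub_zero]
  have hsplit : f = c • (X * g) + (f - c • (X * g)) := by abel
  rcases eq_or_ne c 0 with hc | hc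
  · refine StableOrZero.of_perturbation hΩo (q := T (X * g)) ?_
    filter_upwards [self_mem_nhdsWithin] with ε hpos
    have hε0 : (ε : ℂ) ≠ 0 := by exact_mod_cast (Set.mem_Ioi.mp hpos).ne'
    have h1 := step' ε hε0 f (by simpa [hc] using hq)
    rwa [map_add, map_smul, add_comm] at h1
  · rw [hsplit]
    exact step' c hc _ hq

end Operators

/-! ### Half-planes of roots for which a functional does not vanish -/

lemma le_of_isPreconnected_of_gap {Y : Type*} [TopologicalSpace Y] {S : Set Y}
    (hS : IsPreconnected S) {h : Y → ℝ} (hc : ContinuousOn h S) {lo hi : ℝ} (hlt : lo < hi)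
    (hgap : ∀ x ∈ S, h x ∉ Set.Ioo lo hi) {x y : Y} (hx : x ∈ S) (hy : y ∈ S) (hhi : hi ≤ h x) :
    hi ≤ h y := by
  by_contra hcon
  have hlo : h y ≤ lo := by
    by_contra hlo
    exact hgap y hy ⟨not_le.mp hlo, not_le.mp hcon⟩
  obtain ⟨z, hz, hzm⟩ := hS.intermediate_value hy hx hc
    (show (lo + hi) / 2 ∈ Set.Icc (h y) (h x) from ⟨by linarith, by linarith⟩)
  exact hgap z hz (by rw [hzm]; constructor <;> linarith)

section

variable {ℓ : ℂ →L[ℝ] ℝ} {lo hi : ℝ}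

/-- The zero `y = (b x - c) / (a x - b)` of the form depends continuously on `x` in the half-plane,
avoids the strip, and by symmetry lies beyond the strip for `x` in the strip, hence for all `x`. -/
lemma biaffine_ne_zero_of_half_plane {v x₀ : ℂ} (hv : v ≠ 0) (hℓv : ℓ v = 0)
    (hx₀ : ℓ x₀ ∈ Set.Ioo lo hi) {a b c : ℂ}
    (h : ∀ x y, ℓ x < hi → ℓ y ∈ Set.Ioo lo hi → a * x * y - b * (x + y) + c ≠ 0)
    {x y : ℂ} (hx : ℓ x < hi) (hy : ℓ y < hi) : a * x * y - b * (x + y) + c ≠ 0 := by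
  have hlt : lo < hi := hx₀.1.trans hx₀.2
  have hpole : (a = 0 ∧ b = 0) ∨ ∀ z, ℓ z < hi → a * z - b ≠ 0 := by
    by_contra! hcon
    obtain ⟨hab, z, hz, hazb⟩ := hcon
    have hb : b = a * z := by linear_combination -hazb
    have ha : a ≠ 0 := fun ha => hab ha (by simp [hb, ha])
    -- Near the pole `z` the zero `y` is large, and it takes large values inside the strip.
    have hcont : Tendsto (fun ε : ℝ => z + (b * z - c) / a * (ε / (ε * (x₀ - z) + v)))
        (𝓝 0) (𝓝 z) := by
      have : ContinuousAt (fun ε : ℝ => z + (b * z - c) / a * (ε / (ε * (x₀ - z) + v))) 0 := by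
        have : ((0 : ℝ) : ℂ) * (x₀ - z) + v ≠ 0 := by simpa using hv
        fun_prop (disch := assumption)
      simpa [ContinuousAt] using this
    have hev1 : ∀ᶠ ε : ℝ in 𝓝[>] 0, ℓ (z + (b * z - c) / a * (ε / (ε * (x₀ - z) + v))) < hi :=
      ((ℓ.continuous.tendsto z).comp (hcont.mono_left nhdsWithin_le_nhds)).eventually_lt_const hz
    have hev2 : ∀ᶠ ε : ℝ in 𝓝[>] 0, (ε : ℂ) * (x₀ - z) + v ≠ 0 := by
      have hc : Continuous fun ε : ℝ => (ε : ℂ) * (x₀ - z) + v := by fun_prop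
      exact ((hc.tendsto 0).mono_left nhdsWithin_le_nhds).eventually_ne (by simpa using hv)
    obtain ⟨ε, ⟨h1, h2⟩, h3⟩ := ((hev1.and hev2).and self_mem_nhdsWithin).exists
    have hεR : ε ≠ 0 := (Set.mem_Ioi.mp h3).ne'
    have hε : (ε : ℂ) ≠ 0 := by exact_mod_cast hεR
    refine h _ (x₀ + ε⁻¹ • v) h1 (by rwa [map_add, map_smul, hℓv, smul_zero, add_zero]) ?_
    rw [hb, Complex.real_smul, Complex.ofReal_inv]
    field_simp
    ring
  rcases hpole with ⟨rfl, rfl⟩ | hpole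
  · simpa using h x₀ x₀ hx₀.2 hx₀
  intro h0
  have hsol (z w : ℂ) (hz : ℓ z < hi) :
      a * z * w - b * (z + w) + c = 0 ↔ w = (b * z - c) / (a * z - b) := by
    rw [eq_div_iff (hpole z hz), ← sub_eq_zero (b := b * z - c)]
    ring_nf
  have hcont : ContinuousOn (fun z => ℓ ((b * z - c) / (a * z - b))) (ℓ ⁻¹' Set.Iio hi) := by
    refine ℓ.continuous.comp_continuousOn (ContinuousOn.div (by fun_prop) (by fun_prop) ?_)
    exact fun z hz => hpole z hz
  have hconn : IsPreconnected (ℓ ⁻¹' Set.Iio hi) :=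
    ((convex_Iio hi).linear_preimage ℓ.toLinearMap).isPreconnected
  have h1 : hi ≤ ℓ ((b * x₀ - c) / (a * x₀ - b)) := by
    by_contra! hlt'
    refine h _ x₀ hlt' hx₀ ?_
    rw [← (hsol x₀ _ hx₀.2).mpr rfl]
    ring
  have h2 : hi ≤ ℓ ((b * x - c) / (a * x - b)) := by
    refine le_of_isPreconnected_of_gap hconn hcont hlt (fun z hz hmem => ?_)
      (show x₀ ∈ _ from hx₀.2) hx h1
    exact h z _ hz hmem ((hsol z _ hz).mpr rfl)
  rw [← (hsol x y hx).mp h0] at h2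
  exact absurd hy h2.not_gt

/-- The symmetric multiaffine form `(ζ₁, …, ζₙ) ↦ L (∏ (X - ζᵢ))`: if it has no zero with one
variable in the half-plane and the others in the strip, the other variables may be moved into the
half-plane one by one. -/
lemma functional_rootPoly_ne_zero {v x₀ : ℂ} (hv : v ≠ 0) (hℓv : ℓ v = 0)
    (hx₀ : ℓ x₀ ∈ Set.Ioo lo hi) (L : ℂ[X] →ₗ[ℂ] ℂ) {m : ℕ}
    (h : ∀ x, ℓ x < hi → ∀ t : Multiset ℂ, (∀ a ∈ t, ℓ a ∈ Set.Ioo lo hi) → t.card = m →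
      L ((X - C x) * rootPoly t) ≠ 0)
    {s : Multiset ℂ} (hs : ∀ a ∈ s, ℓ a < hi) (hcard : s.card = m + 1) : L (rootPoly s) ≠ 0 := by
  have key : ∀ s t : Multiset ℂ, (∀ a ∈ s, ℓ a < hi) → (∀ a ∈ t, ℓ a ∈ Set.Ioo lo hi) →
      s.card + t.card = m → ∀ x, ℓ x < hi → L ((X - C x) * rootPoly (s + t)) ≠ 0 := by
    intro s
    induction s using Multiset.induction with
    | empty =>
      intro t _ ht hm x hx
      rw [zero_add]
      exact h x hx t ht (by simpa using hm)
    | cons y s ih =>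
      intro t hs ht hm x hx
      have hexp : ∀ x y : ℂ, L ((X - C x) * rootPoly (y ::ₘ (s + t))) =
          L (rootPoly (s + t)) * x * y - L (X * rootPoly (s + t)) * (x + y) +
            L (X * (X * rootPoly (s + t))) := by
        intro x y
        have : (X - C x) * rootPoly (y ::ₘ (s + t)) =
            (x * y) • rootPoly (s + t) - (x + y) • (X * rootPoly (s + t)) +
              X * (X * rootPoly (s + t)) := by
          rw [rootPoly_cons, smul_eq_C_mul, smul_eq_C_mul, C_mul, C_add]
          ring
        rw [this, map_add, map_sub, map_smul, map_smul, smul_eq_mul, smul_eq_mul]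
        ring
      rw [Multiset.cons_add, hexp]
      refine biaffine_ne_zero_of_half_plane hv hℓv hx₀ (fun x y hx hy => ?_) hx
        (hs y (Multiset.mem_cons_self y s))
      rw [← hexp, ← Multiset.add_cons]
      refine ih (y ::ₘ t) (fun a ha => hs a (Multiset.mem_cons_of_mem ha)) ?_ ?_ x hx
      · intro a ha
        rcases Multiset.mem_cons.mp ha with rfl | ha
        exacts [hy, ht a ha]
      · rw [Multiset.card_cons] at hm ⊢
        omega
  obtain ⟨x, s', rfl⟩ := Multiset.card_pos_iff_exists_mem.mp (show 0 < s.card by omega)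
    |>.imp fun x hx => Multiset.exists_cons_of_mem hx
  have := key s' 0 (fun a ha => hs a (Multiset.mem_cons_of_mem ha)) (by simp)
    (by simpa using hcard) x (hs x (Multiset.mem_cons_self x s'))
  rwa [add_zero, ← rootPoly_cons] at this

variable {T : ℂ[X] →ₗ[ℂ] ℂ[X]} {K : Set ℂ}

/-- The polynomial `T (∏ (X - ζᵢ))` at `w`, as an affine function of `ζ₁`, has a zero that varies
continuously with `ζ₂, …, ζₙ` in the strip and with `w`. As it avoids the strip, it stays on one
side of it. -/
lemma half_plane_dichotomy (hlt : lo < hi) (hK : IsPreconnected K) {m : ℕ}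
    (hA : ∀ s : Multiset ℂ, (∀ a ∈ s, ℓ a ∈ Set.Ioo lo hi) → s.card = m →
      IsStableOn K (T (rootPoly s)))
    (hB : ∀ s : Multiset ℂ, (∀ a ∈ s, ℓ a ∈ Set.Ioo lo hi) → s.card = m + 1 →
      IsStableOn K (T (rootPoly s))) :
    (∀ x, ℓ x < hi → ∀ t : Multiset ℂ, (∀ a ∈ t, ℓ a ∈ Set.Ioo lo hi) → t.card = m →
      IsStableOn K (T ((X - C x) * rootPoly t))) ∨
    (∀ x, lo < ℓ x → ∀ t : Multiset ℂ, (∀ a ∈ t, ℓ a ∈ Set.Ioo lo hi) → t.card = m →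
      IsStableOn K (T ((X - C x) * rootPoly t))) := by
  set ξ : Multiset ℂ → ℂ → ℂ := fun s w =>
    (T (X * rootPoly s)).eval w / (T (rootPoly s)).eval w with hξ
  have hsol (s : Multiset ℂ) (hs : ∀ a ∈ s, ℓ a ∈ Set.Ioo lo hi) (hm : s.card = m) (w : ℂ)
      (hw : w ∈ K) (x : ℂ) : (T ((X - C x) * rootPoly s)).eval w = 0 ↔ x = ξ s w := by
    have : (X - C x) * rootPoly s = X * rootPoly s - x • rootPoly s := by
      rw [smul_eq_C_mul]; ring
    rw [hξ, eq_div_iff (hA s hs hm w hw), this, map_sub, map_smul, eval_sub, eval_smul,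
      smul_eq_mul, sub_eq_zero, eq_comm]
  have hgap (s : Multiset ℂ) (hs : ∀ a ∈ s, ℓ a ∈ Set.Ioo lo hi) (hm : s.card = m) (w : ℂ)
      (hw : w ∈ K) : ℓ (ξ s w) ∉ Set.Ioo lo hi := by
    intro hmem
    refine hB (ξ s w ::ₘ s) ?_ (by simp [hm]) w hw ?_
    · intro a ha
      rcases Multiset.mem_cons.mp ha with rfl | ha
      exacts [hmem, hs a ha]
    · rw [rootPoly_cons]
      exact (hsol s hs hm w hw _).mpr rfl
  have hmove_w (s : Multiset ℂ) (hs : ∀ a ∈ s, ℓ a ∈ Set.Ioo lo hi) (hm : s.card = m) (w w' : ℂ)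
      (hw : w ∈ K) (hw' : w' ∈ K) (hle : hi ≤ ℓ (ξ s w)) : hi ≤ ℓ (ξ s w') := by
    refine le_of_isPreconnected_of_gap hK (h := fun w => ℓ (ξ s w)) ?_ hlt
      (fun w hw => hgap s hs hm w hw) hw hw' hle
    exact ℓ.continuous.comp_continuousOn ((Polynomial.continuousOn _).div
      (Polynomial.continuousOn _) fun w hw => hA s hs hm w hw)
  have hmove_root (r : Multiset ℂ) (hr : ∀ a ∈ r, ℓ a ∈ Set.Ioo lo hi) (hm : r.card + 1 = m)
      (w : ℂ) (hw : w ∈ K) (a a' : ℂ) (ha : ℓ a ∈ Set.Ioo lo hi) (ha' : ℓ a' ∈ Set.Ioo lo hi)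
      (hle : hi ≤ ℓ (ξ (a ::ₘ r) w)) : hi ≤ ℓ (ξ (a' ::ₘ r) w) := by
    have hconn : IsPreconnected (ℓ ⁻¹' Set.Ioo lo hi) :=
      ((convex_Ioo lo hi).linear_preimage ℓ.toLinearMap).isPreconnected
    have hmem (z : ℂ) (hz : ℓ z ∈ Set.Ioo lo hi) : ∀ c ∈ z ::ₘ r, ℓ c ∈ Set.Ioo lo hi := by
      intro c hc
      rcases Multiset.mem_cons.mp hc with rfl | hc
      exacts [hz, hr c hc]
    refine le_of_isPreconnected_of_gap hconn (h := fun z => ℓ (ξ (z ::ₘ r) w)) ?_ hlt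
      (fun z hz => hgap _ (hmem z hz) (by simp [hm]) w hw) ha ha' hle
    refine ℓ.continuous.comp_continuousOn (ContinuousOn.div ?_ ?_
      fun z hz => hA _ (hmem z hz) (by simp [hm]) w hw)
    · have : (fun z => (T (X * rootPoly (z ::ₘ r))).eval w) =
          fun z => (T (X * (X * rootPoly r))).eval w - z * (T (X * rootPoly r)).eval w := by
        ext z
        have : X * rootPoly (z ::ₘ r) = X * (X * rootPoly r) - z • (X * rootPoly r) := by
          rw [rootPoly_cons, smul_eq_C_mul]; ring
        rw [this, map_sub, map_smul, eval_sub, eval_smul, smul_eq_mul]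
      rw [this]
      fun_prop
    · have : (fun z => (T (rootPoly (z ::ₘ r))).eval w) =
          fun z => (T (X * rootPoly r)).eval w - z * (T (rootPoly r)).eval w := by
        ext z
        have : rootPoly (z ::ₘ r) = X * rootPoly r - z • rootPoly r := by
          rw [rootPoly_cons, smul_eq_C_mul]; ring
        rw [this, map_sub, map_smul, eval_sub, eval_smul, smul_eq_mul]
      rw [this]
      fun_prop
  have hmove (w : ℂ) (hw : w ∈ K) : ∀ s s' r : Multiset ℂ, (∀ a ∈ s, ℓ a ∈ Set.Ioo lo hi) →
      (∀ a ∈ s', ℓ a ∈ Set.Ioo lo hi) → (∀ a ∈ r, ℓ a ∈ Set.Ioo lo hi) → s.card + r.card = m →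
      s'.card + r.card = m → hi ≤ ℓ (ξ (s + r) w) → hi ≤ ℓ (ξ (s' + r) w) := by
    intro s
    induction s using Multiset.induction with
    | empty =>
      intro s' r _ _ _ hm hm' hle
      have : s' = 0 := Multiset.card_eq_zero.mp (by rw [Multiset.card_zero] at hm; omega)
      rwa [this]
    | cons a s ih =>
      intro s' r hs hs' hr hm hm' hle
      rw [Multiset.card_cons] at hm
      obtain ⟨a', s', rfl⟩ := Multiset.card_pos_iff_exists_mem.mp (show 0 < s'.card by omega)
        |>.imp fun x hx => Multiset.exists_cons_of_mem hx
      rw [Multiset.card_cons] at hm'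
      have ha' := hs' a' (Multiset.mem_cons_self a' s')
      rw [Multiset.cons_add] at hle ⊢
      rw [← Multiset.add_cons]
      refine ih s' (a' ::ₘ r) (fun c hc => hs c (Multiset.mem_cons_of_mem hc))
        (fun c hc => hs' c (Multiset.mem_cons_of_mem hc)) ?_ ?_ ?_ ?_
      · intro c hc
        rcases Multiset.mem_cons.mp hc with rfl | hc
        exacts [ha', hr c hc]
      · rw [Multiset.card_cons]; omega
      · rw [Multiset.card_cons]; omega
      · rw [Multiset.add_cons]
        refine hmove_root (s + r) ?_ ?_ w hw a a' (hs a (Multiset.mem_cons_self a s)) ha' hle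
        · intro c hc
          rcases Multiset.mem_add.mp hc with hc | hc
          exacts [hs c (Multiset.mem_cons_of_mem hc), hr c hc]
        · rw [Multiset.card_add]; omega
  by_cases hex : ∃ s : Multiset ℂ, (∀ a ∈ s, ℓ a ∈ Set.Ioo lo hi) ∧ s.card = m ∧
      ∃ w ∈ K, hi ≤ ℓ (ξ s w)
  · obtain ⟨s, hs, hm, w, hw, hle⟩ := hex
    left
    intro x hx t ht hmt w' hw' h0
    have h1 : hi ≤ ℓ (ξ t w) := by
      simpa using hmove w hw s t 0 hs ht (by simp) (by simpa) (by simpa) (by simpa)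
    have h2 := hmove_w t ht hmt w w' hw hw' h1
    rw [← (hsol t ht hmt w' hw' x).mp h0] at h2
    exact absurd hx h2.not_gt
  · push Not at hex
    right
    intro x hx t ht hmt w hw h0
    have h1 := hex t ht hmt w hw
    rw [← (hsol t ht hmt w hw x).mp h0] at h1
    refine hgap t ht hmt w hw ?_
    rw [← (hsol t ht hmt w hw x).mp h0]
    exact ⟨hx, h1⟩

/-! ### From monic polynomials of full degree to all polynomials -/

/-- Roots on the boundary line are limits of roots in the half-plane, and missing roots are
limits of roots that run to infinity along the boundary direction. -/
lemma stableOrZero_of_rootPoly (hK : IsOpen K) {e v : ℂ} (he : 0 < ℓ e) (hv : v ≠ 0)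
    (hℓv : ℓ v = 0) {n : ℕ}
    (h : ∀ s : Multiset ℂ, (∀ a ∈ s, ℓ a < hi) → s.card = n → IsStableOn K (T (rootPoly s)))
    {f : ℂ[X]} (hf : f.natDegree ≤ n) (hst : IsStableOn (ℓ ⁻¹' Set.Ioi hi) f) :
    StableOrZero K (T f) := by
  have hclosed : ∀ s t : Multiset ℂ, (∀ a ∈ s, ℓ a ≤ hi) → (∀ a ∈ t, ℓ a < hi) →
      s.card + t.card = n → StableOrZero K (T (rootPoly (s + t))) := by
    intro s
    induction s using Multiset.induction with
    | empty => intro t _ ht hn; exact Or.inl (h _ (by simpa using ht) (by simpa using hn))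
    | cons x s ih =>
      intro t hs ht hn
      refine StableOrZero.of_perturbation hK (q := T (e • rootPoly (s + t))) ?_
      filter_upwards [self_mem_nhdsWithin] with ε hε
      have h1 : rootPoly (s + (x - ε • e) ::ₘ t) =
          rootPoly (x ::ₘ s + t) + (ε : ℂ) • (e • rootPoly (s + t)) := by
        rw [Multiset.add_cons, Multiset.cons_add, rootPoly_cons, rootPoly_cons, Complex.real_smul,
          smul_eq_C_mul, smul_eq_C_mul, C_sub, C_mul]
        ring
      rw [← map_smul, ← map_add, ← h1]
      refine ih _ (fun a ha => hs a (Multiset.mem_cons_of_mem ha)) ?_ ?_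
      · intro a ha
        rcases Multiset.mem_cons.mp ha with rfl | ha
        · have h2 := hs x (Multiset.mem_cons_self x s)
          have h3 := mul_pos (Set.mem_Ioi.mp hε) he
          rw [map_sub, map_smul, smul_eq_mul]
          linarith
        · exact ht a ha
      · rw [Multiset.card_cons] at hn ⊢
        omega
  have hdeg : ∀ j : ℕ, ∀ s : Multiset ℂ, (∀ a ∈ s, ℓ a ≤ hi) → s.card + j = n →
      StableOrZero K (T (rootPoly s)) := by
    intro j
    induction j with
    | zero => intro s hs hn; simpa using hclosed s 0 hs (by simp) (by simpa using hn)
    | succ j ih =>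
      intro s hs hn
      obtain ⟨b, hb⟩ : ∃ b, ℓ b = hi :=
        ⟨(hi / ℓ e) • e, by rw [map_smul, smul_eq_mul, div_mul_cancel₀ _ he.ne']⟩
      refine StableOrZero.of_perturbation hK (q := T (v⁻¹ • ((X - C b) * rootPoly s))) ?_
      filter_upwards [self_mem_nhdsWithin] with ε hε
      have hεR : ε ≠ 0 := (Set.mem_Ioi.mp hε).ne'
      have h1 : rootPoly s + (ε : ℂ) • (v⁻¹ • ((X - C b) * rootPoly s)) =
          ((ε : ℂ) * v⁻¹) • rootPoly ((b - ε⁻¹ • v) ::ₘ s) := by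
        rw [rootPoly_cons, ← smul_mul_assoc ((ε : ℂ) * v⁻¹), ← distantFactor_eq hv hεR,
          distantFactor, add_mul, one_mul, smul_mul_assoc, smul_mul_assoc]
      rw [← map_smul, ← map_add, h1, map_smul]
      refine (ih _ ?_ ?_).smul _
      · intro a ha
        rcases Multiset.mem_cons.mp ha with rfl | ha
        · rw [map_sub, map_smul, hℓv, smul_zero, sub_zero, hb]
        · exact hs a ha
      · rw [Multiset.card_cons]; omega
  rw [eq_smul_rootPoly_roots f, map_smul]
  refine (hdeg (n - f.roots.card) f.roots (fun a ha => ?_) ?_).smul _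
  · by_contra! hlt
    exact hst a hlt (isRoot_of_mem_roots ha)
  · have := (card_roots' f).trans hf
    omega

/-- One of the two half-planes can serve as source for the connected target region `K`. The
hypothesis `hnd` is the nondegeneracy of `T`; it fails for `n = 0`. -/
lemma stableOrZero_or_stableOrZero {Ω : Set ℂ} (hlt : lo < hi)
    (hΩ : Ω ⊆ (ℓ ⁻¹' Set.Ioo lo hi)ᶜ) (hΩo : IsOpen Ω) (hKo : IsOpen K) (hK : IsPreconnected K)
    (hKΩ : K ⊆ Ω) {e v : ℂ} (he : 0 < ℓ e) (hv : v ≠ 0) (hℓv : ℓ v = 0) {n : ℕ}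
    (hT : ∀ f : ℂ[X], f.natDegree ≤ n → IsStableOn Ω f → StableOrZero Ω (T f))
    (hnd : ∃ f : ℂ[X], f.natDegree ≤ n ∧ ¬ StableOrZero Ω (T f)) :
    (∀ f : ℂ[X], f.natDegree ≤ n → IsStableOn (ℓ ⁻¹' Set.Ioi hi) f → StableOrZero K (T f)) ∨
    (∀ f : ℂ[X], f.natDegree ≤ n → IsStableOn (ℓ ⁻¹' Set.Iio lo) f → StableOrZero K (T f)) := by
  obtain ⟨b, hb⟩ : ∃ b, ℓ b ∈ Set.Ioo lo hi := by
    refine ⟨((lo + hi) / 2 / ℓ e) • e, ?_⟩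
    rw [map_smul, smul_eq_mul, div_mul_cancel₀ _ he.ne']
    constructor <;> linarith
  obtain ⟨m, rfl⟩ : ∃ m, n = m + 1 := by
    refine Nat.exists_eq_succ_of_ne_zero ?_
    rintro rfl
    obtain ⟨f, hf, hfT⟩ := hnd
    rw [eq_C_of_natDegree_le_zero hf] at hfT
    rcases eq_or_ne (f.coeff 0) 0 with h0 | h0
    · exact hfT (by rw [h0, C_0, map_zero]; exact Or.inr rfl)
    · exact hfT (hT _ (by simp) fun z _ => by simpa using h0)
  have hstable (s : Multiset ℂ) (hs : ∀ a ∈ s, ℓ a ∈ Set.Ioo lo hi) (hle : s.card ≤ m + 1)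
      (hne : T (rootPoly s) ≠ 0) : IsStableOn K (T (rootPoly s)) := by
    have h1 := hT (rootPoly s) (by simpa using hle)
      (isStableOn_rootPoly fun a ha hmem => hΩ hmem (hs a ha))
    exact fun w hw => h1.resolve_right hne w (hKΩ hw)
  have hA (s : Multiset ℂ) (hs : ∀ a ∈ s, ℓ a ∈ Set.Ioo lo hi) (hm : s.card = m) :
      IsStableOn K (T (rootPoly s)) :=
    hstable s hs (by omega)
      (map_rootPoly_ne_zero_of_card_succ hΩ hΩo hv hℓv hb hT hnd hs (by omega))
  have hB (s : Multiset ℂ) (hs : ∀ a ∈ s, ℓ a ∈ Set.Ioo lo hi) (hm : s.card = m + 1) :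
      IsStableOn K (T (rootPoly s)) :=
    hstable s hs hm.le (map_rootPoly_ne_zero isOpen_preimage_Ioo hΩ hT hnd hs hm)
  refine (half_plane_dichotomy hlt hK hA hB).imp (fun h f hf hst => ?_) fun h f hf hst => ?_
  · refine stableOrZero_of_rootPoly hKo he hv hℓv (fun s hs hm w hw => ?_) hf hst
    exact functional_rootPoly_ne_zero hv hℓv hb (leval w ∘ₗ T)
      (fun x hx t ht htm => h x hx t ht htm w hw) hs hm
  · -- The other side is the same statement for `-ℓ`.
    have hneg (x : ℂ) : (-ℓ) x ∈ Set.Ioo (-hi) (-lo) ↔ ℓ x ∈ Set.Ioo lo hi := by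
      simp [and_comm]
    refine stableOrZero_of_rootPoly (ℓ := -ℓ) (hi := -lo) hKo (e := -e) (by simpa using he) hv
      (by simpa using hℓv) (fun s hs hm w hw => ?_) hf fun z hz => hst z (by simpa using hz)
    refine functional_rootPoly_ne_zero (ℓ := -ℓ) (lo := -hi) hv (by simpa using hℓv)
      ((hneg b).mpr hb) (leval w ∘ₗ T) (fun x hx t ht htm => ?_) hs hm
    exact h x (by simpa using hx) t (fun a ha => (hneg a).mp (ht a ha)) htm w hw

end

/-! ### The two half-planes -/

/-- The real linear functional `z ↦ Re (conj u * z)` whose superlevel sets are the half-planes with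
inner normal `u`. -/
noncomputable def normalFunctional (u : ℂ) : ℂ →L[ℝ] ℝ :=
  Complex.reCLM ∘L ContinuousLinearMap.mul ℝ ℂ ((starRingEnd ℂ) u)

lemma normalFunctional_apply (u z : ℂ) : normalFunctional u z = ((starRingEnd ℂ) u * z).re := rfl

lemma normalFunctional_self_pos {u : ℂ} (hu : u ≠ 0) : 0 < normalFunctional u u := by
  rw [normalFunctional_apply, ← Complex.normSq_eq_conj_mul_self, Complex.ofReal_re]
  exact Complex.normSq_pos.mpr hu

lemma normalFunctional_I_mul_self (u : ℂ) : normalFunctional u (Complex.I * u) = 0 := by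
  rw [normalFunctional_apply, mul_left_comm, ← Complex.normSq_eq_conj_mul_self]
  simp

lemma openHalfPlane_eq_preimage (u : ℂ) (c : ℝ) :
    openHalfPlane u c = normalFunctional u ⁻¹' Set.Ioi c := rfl

lemma openHalfPlane_neg_eq_preimage (u : ℂ) (c : ℝ) :
    openHalfPlane (-u) c = normalFunctional u ⁻¹' Set.Iio (-c) := by
  ext z
  simp only [openHalfPlane, Set.mem_ofPred_eq, map_neg, neg_mul, Complex.neg_re, Set.mem_preimage,
    Set.mem_Iio, normalFunctional_apply]
  exact lt_neg

/-- A closed half-plane is not a strip: it contains a ray in each normal direction of the strip, up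
to sign. -/
lemma not_isClosedStrip_compl_openHalfPlane {u : ℂ} (hu : u ≠ 0) (c : ℝ) :
    ¬ IsClosedStrip (openHalfPlane u c)ᶜ := by
  rintro ⟨w, hw, a, b, -, hS⟩
  have hpos := normalFunctional_self_pos hw
  have hmem (z : ℂ) : normalFunctional u z ≤ c ↔
      a ≤ normalFunctional w z ∧ normalFunctional w z ≤ b := by
    have := Set.ext_iff.mp hS z
    rwa [openHalfPlane_eq_preimage, Set.mem_compl_iff, Set.mem_preimage, Set.mem_Ioi, not_lt]
      at this
  obtain ⟨z₀, hz₀⟩ : ∃ z₀, normalFunctional u z₀ ≤ c := by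
    refine ⟨(c / normalFunctional u u) • u, ?_⟩
    rw [map_smul, smul_eq_mul, div_mul_cancel₀ _ (normalFunctional_self_pos hu).ne']
  have hray (d : ℂ) (hd : normalFunctional u d ≤ 0) (t : ℝ) (ht : 0 ≤ t) :
      a ≤ normalFunctional w z₀ + t * normalFunctional w d ∧
        normalFunctional w z₀ + t * normalFunctional w d ≤ b := by
    have := (hmem (z₀ + t • d)).mp (by
      rw [map_add, map_smul, smul_eq_mul]
      nlinarith [mul_nonneg ht (neg_nonneg.mpr hd)])
    rwa [map_add, map_smul, smul_eq_mul] at this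
  have h0 := (hmem z₀).mp hz₀
  have ht : 0 ≤ (b - a + 1) / normalFunctional w w := div_nonneg (by linarith) hpos.le
  rcases le_total (normalFunctional u w) 0 with h | h
  · have := (hray w h _ ht).2
    rw [div_mul_cancel₀ _ hpos.ne'] at this
    linarith
  · have := (hray (-w) (by simpa using h) _ ht).1
    rw [map_neg, mul_neg, div_mul_cancel₀ _ hpos.ne'] at this
    linarith

lemma lt_of_interior_preimage_Icc_nonempty {ℓ : ℂ →L[ℝ] ℝ} {e : ℂ} (he : 0 < ℓ e) {lo hi : ℝ}
    (h : (interior (ℓ ⁻¹' Set.Icc lo hi)).Nonempty) : lo < hi := by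
  obtain ⟨z, hz⟩ := h
  have hc : Continuous fun t : ℝ => z + t • e := by fun_prop
  have hev : ∀ᶠ t : ℝ in 𝓝[>] 0, z + t • e ∈ ℓ ⁻¹' Set.Icc lo hi := by
    have h1 := (hc.tendsto 0).mono_left (nhdsWithin_le_nhds (s := Set.Ioi 0))
    rw [zero_smul, add_zero] at h1
    exact h1.eventually (mem_interior_iff_mem_nhds.mp hz)
  obtain ⟨t, ht, hpos⟩ := (hev.and self_mem_nhdsWithin).exists
  have h1 := (interior_subset hz).1
  have h2 := ht.2
  have h3 := mul_pos (Set.mem_Ioi.mp hpos) he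
  rw [map_add, map_smul, smul_eq_mul] at h2
  linarith

lemma mapsStable_iff {n : ℕ} {T : degreeLE ℂ (n : WithBot ℕ) →ₗ[ℂ] ℂ[X]} {S : ℂ[X] →ₗ[ℂ] ℂ[X]}
    (hS : ∀ f : degreeLE ℂ (n : WithBot ℕ), S f = T f) {Ω Ω' : Set ℂ} :
    MapsStable T Ω Ω' ↔
      ∀ f : ℂ[X], f.natDegree ≤ n → IsStableOn Ω f → StableOrZero Ω' (S f) := by
  constructor
  · intro h f hf hst
    have := h ⟨f, mem_degreeLE.mpr (natDegree_le_iff_degree_le.mp hf)⟩ hst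
    rwa [← hS] at this
  · intro h f hst
    rw [← hS]
    exact h f (natDegree_le_iff_degree_le.mpr (mem_degreeLE.mp f.2)) hst

theorem theorem1p2 (n : ℕ) (H₁ H₂ : Set ℂ)
    (hpar : AreParallelOpenHalfPlanes H₁ H₂)
    (hstrip : IsClosedStrip (H₁ ∪ H₂)ᶜ)
    (hint : (interior (H₁ ∪ H₂)ᶜ).Nonempty)
    (T : degreeLE ℂ (n : WithBot ℕ) →ₗ[ℂ] ℂ[X]) :
    PreservesStability T (H₁ ∪ H₂) ↔
      ((LinearMap.rank T ≤ 1 ∧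
          ∃ (α : degreeLE ℂ (n : WithBot ℕ) →ₗ[ℂ] ℂ) (p : ℂ[X]),
            IsStableOn (H₁ ∪ H₂) p ∧ ∀ f, T f = α f • p) ∨
        ((MapsStable T H₁ H₁ ∨ MapsStable T H₂ H₁) ∧
          (MapsStable T H₁ H₂ ∨ MapsStable T H₂ H₂))) := by
  constructor
  swap
  · rintro (⟨-, α, p, hp, hT⟩ | ⟨h1, h2⟩) f hf
    · rw [hT]
      exact StableOrZero.smul (Or.inl hp) (α f)
    · have hf1 : IsStableOn H₁ (f : ℂ[X]) := fun z hz => hf z (Or.inl hz)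
      have hf2 : IsStableOn H₂ (f : ℂ[X]) := fun z hz => hf z (Or.inr hz)
      have h1' := h1.elim (fun h => h f hf1) fun h => h f hf2
      have h2' := h2.elim (fun h => h f hf1) fun h => h f hf2
      rcases h1' with h1' | h0
      · exact h2'.imp_left fun h2' z hz => hz.elim (h1' z) (h2' z)
      · exact Or.inr h0
  intro hT
  obtain ⟨u, hu, c₁, c₂, rfl, rfl | rfl⟩ := hpar
  · -- Two half-planes with the same normal are nested, so their union is a half-plane.
    refine absurd hstrip ?_
    have : openHalfPlane u c₁ ∪ openHalfPlane u c₂ = openHalfPlane u (min c₁ c₂) := by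
      ext z
      simp [openHalfPlane]
    rw [this]
    exact not_isClosedStrip_compl_openHalfPlane hu _
  rw [openHalfPlane_neg_eq_preimage, openHalfPlane_eq_preimage] at *
  have he := normalFunctional_self_pos hu
  have hℓv := normalFunctional_I_mul_self u
  have hv : Complex.I * u ≠ 0 := mul_ne_zero Complex.I_ne_zero hu
  generalize normalFunctional u = ℓ at *
  have hlt : -c₂ < c₁ := by
    refine lt_of_interior_preimage_Icc_nonempty he (hint.mono (interior_mono ?_))
    intro z hz
    simp only [Set.mem_compl_iff, Set.mem_union, Set.mem_preimage, Set.mem_Ioi, Set.mem_Iio,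
      not_or, not_lt] at hz
    exact ⟨hz.2, hz.1⟩
  set Ω := ℓ ⁻¹' Set.Ioi c₁ ∪ ℓ ⁻¹' Set.Iio (-c₂)
  have hΩ : Ω ⊆ (ℓ ⁻¹' Set.Ioo (-c₂) c₁)ᶜ := by
    rintro z (hz | hz) hmem
    exacts [lt_asymm hz hmem.2, lt_asymm hz hmem.1]
  have ho₁ : IsOpen (ℓ ⁻¹' Set.Ioi c₁) := isOpen_Ioi.preimage ℓ.continuous
  have ho₂ : IsOpen (ℓ ⁻¹' Set.Iio (-c₂)) := isOpen_Iio.preimage ℓ.continuous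
  by_cases hdeg : ∀ f, StableOrZero Ω (T f)
  · refine Or.inl (rank_le_one_of_forall_stableOrZero ?_ T hdeg)
    refine ⟨((c₁ + 1) / ℓ u) • u, Or.inl ?_⟩
    rw [Set.mem_preimage, map_smul, smul_eq_mul, div_mul_cancel₀ _ he.ne']
    exact lt_add_one c₁
  right
  obtain ⟨S, hS⟩ := T.exists_extend
  replace hS (f : degreeLE ℂ (n : WithBot ℕ)) : S f = T f := LinearMap.congr_fun hS f
  have hT' := (mapsStable_iff hS).mp hT
  have hnd : ∃ f : ℂ[X], f.natDegree ≤ n ∧ ¬ StableOrZero Ω (S f) := by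
    push Not at hdeg
    obtain ⟨f, hf⟩ := hdeg
    exact ⟨f, natDegree_le_iff_degree_le.mpr (mem_degreeLE.mp f.2), by rwa [hS]⟩
  simp only [mapsStable_iff hS]
  exact ⟨stableOrZero_or_stableOrZero hlt hΩ (ho₁.union ho₂) ho₁
      ((convex_Ioi c₁).linear_preimage ℓ.toLinearMap).isPreconnected Set.subset_union_left
      he hv hℓv hT' hnd,
    stableOrZero_or_stableOrZero hlt hΩ (ho₁.union ho₂) ho₂
      ((convex_Iio (-c₂)).linear_preimage ℓ.toLinearMap).isPreconnected Set.subset_union_right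
      he hv hℓv hT' hnd⟩
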